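/- Let $p$ be a prime and let $R$ be a noetherian commutative $\mathbb{F}_p$-algebra that is $F$-finite, i.e. the Frobenius $F\colon R\to R$, $r\mapsto r^p$, is a finite ring homomorphism. Let $R[F]=R\{F\}/\langle r^pF-Fr \mid r\in R\rangle$, and let $\operatorname{QCoh}_\kappa(R)$ be the category of Cartier modules, i.e. of right $R[F]$-modules. For a Cartier module $M$, right multiplication by $F$ is an $R$-linear map $C_M\colon F_*M\to M$; let $\kappa_M\colon M\to F^\flat M=\operatorname{Hom}_R(F_*R,M)$ be its adjoint. Give $F^\flat M$ the Cartier module structure whose adjoint structural map is $F^\flat(\kappa_M)$; then $\kappa_M$ is a morphism of Cartier modules. Call $M$ a unit Cartier module if $\kappa_M$ is an isomorphism, and let $\iota\colon\operatorname{QCoh}_\kappa^{\mathrm{unit}}(R)\hookrightarrow\operatorname{QCoh}_\kappa(R)$ be the full subcategory of unit Cartier modules. The unitalization of $M$ is $$u(M)=\operatorname{colim}\bigl(M\xrightarrow{\kappa_M}F^\flat M\xrightarrow{F^\flat\kappa_M}F^{2\flat}M\to\cdots\bigr),$$ the colimit being taken in Cartier modules, and $\eta\colon\operatorname{id}\to u$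 is the canonical natural transformation. A Cartier module is locally nilpotent if it is the union of Cartier submodules on each of which some power of $F$ acts as zero. Let $\operatorname{LNil}_\kappa(R)$ be the Serre subcategory of locally nilpotent Cartier modules, and let $\pi\colon\operatorname{QCoh}_\kappa(R)\to\operatorname{QCrys}_\kappa(R)=\operatorname{QCoh}_\kappa(R)/\operatorname{LNil}_\kappa(R)$ be the localization functor. Then $\pi$ has a right adjoint $\overline{u}\colon\operatorname{QCrys}_\kappa(R)\to\operatorname{QCoh}_\kappa(R)$ whose values are unit Cartier modules; the functors $\pi\circ\iota\colon\operatorname{QCoh}_\kappa^{\mathrm{unit}}(R)\to\operatorname{QCrys}_\kappa(R)$ and $\overline{u}\colon\operatorname{QCrys}_\kappa(R)\to\operatorname{QCoh}_\kappa^{\mathrm{unit}}(R)$ are mutually quasi-inverse equivalences of categories; and there is a natural isomorphism $\overline{u}\circ\pi\cong u$ that carries the unit $\operatorname{id}\to\overline{u}\circ\pi$ of the adjunction to $\eta$. -/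

import Mathlib

open CategoryTheory CategoryTheory.Limits

universe u

noncomputable section

namespace Cartier

section FrobeniusRing

variable (p : ℕ) [Fact p.Prime] (R : Type u) [CommRing R] [Algebra (ZMod p) R]

/-- The Frobenius endomorphism `F : r ↦ r ^ p` of an `𝔽_p`-algebra (the zero ring is allowed). -/
def frob : R →+* R where
  toFun r := r ^ p
  map_one' := one_pow p
  map_mul' x y := mul_pow x y p
  map_zero' := zero_pow (Fact.out : p.Prime).ne_zero
  map_add' x y := by
    rcases subsingleton_or_nontrivial R with h | h
    · exact Subsingleton.elim _ _
    · have : CharP R p := charP_of_injective_algebraMap (algebraMap (ZMod p) R).injective p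
      exact add_pow_char x y p

@[simp] lemma frob_apply (r : R) : frob p R r = r ^ p := rfl

/-- `R` is `F`-finite: the Frobenius is a finite ring homomorphism. -/
class IsFFinite : Prop where
  finite : (frob p R).Finite

/-- The action of the monoid of powers of `F` on `R` through powers of the Frobenius. -/
@[reducible] def frobAction : MulSemiringAction (Multiplicative ℕ) R :=
  MulSemiringAction.compHom R (powersHom (R →+* R) (frob p R))

/-- The noncommutative ring `R[F] = R{F} / ⟨r ^ p F - F r⟩`, as the skew polynomial ring
`⨁ₑ R Fᵉ` with multiplication determined by `F r = r ^ p F`. -/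
def FrobRing (_ : ℕ) (R : Type u) [CommRing R] : Type u := SkewPolynomial R

instance : Ring (FrobRing p R) :=
  letI := frobAction p R
  inferInstanceAs (Ring (SkewPolynomial R))

/-- The inclusion `R → R[F]`. -/
def coeffHom : R →+* FrobRing p R :=
  letI := frobAction p R
  (SkewPolynomial.CRingHom : R →+* SkewPolynomial R)

/-- The element `F` of `R[F]`. -/
def F : FrobRing p R := (SkewPolynomial.X : SkewPolynomial R)

/-- The defining relation of `R[F]`. -/
lemma F_mul_coeffHom (r : R) : F p R * coeffHom p R r = coeffHom p R (r ^ p) * F p R := by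
  let := frobAction p R
  have h : (SkewPolynomial.X : SkewPolynomial R) * SkewPolynomial.C r
      = SkewPolynomial.C (SkewPolynomial.φ r) * SkewPolynomial.X := by
    rw [← SkewPolynomial.monomial_zero_left, SkewPolynomial.X_mul_monomial,
      ← SkewPolynomial.monomial_zero_left, SkewPolynomial.monomial_mul_X]
  exact h

lemma F_pow_mul_coeffHom (e : ℕ) (r : R) :
    F p R ^ e * coeffHom p R r = coeffHom p R (r ^ p ^ e) * F p R ^ e := by
  induction e generalizing r with
  | zero => simp
  | succ e ih =>
    rw [pow_succ, mul_assoc, F_mul_coeffHom, ← mul_assoc, ih, mul_assoc, ← pow_mul, pow_succ',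
      ← pow_succ]

/-- Every element of `R[F]` is a finite sum of elements `r Fᵉ`. -/
lemma frobRing_induction {motive : FrobRing p R → Prop} (x : FrobRing p R)
    (add : ∀ x y, motive x → motive y → motive (x + y))
    (mono : ∀ (r : R) (e : ℕ), motive (coeffHom p R r * F p R ^ e)) : motive x := by
  let := frobAction p R
  have key : ∀ (n : ℕ) (r : R), motive (SkewPolynomial.monomial n r : SkewPolynomial R) := by
    intro n r
    have h : (SkewPolynomial.monomial n r : SkewPolynomial R)
        = SkewPolynomial.C r * SkewPolynomial.X ^ n :=
      (SkewPolynomial.C_mul_X_pow_eq_monomial (n := n)).symm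
    have h' : (SkewPolynomial.monomial n r : SkewPolynomial R)
        = (coeffHom p R r * F p R ^ n : FrobRing p R) := h
    rw [h']
    exact mono r n
  refine SkewPolynomial.induction (motive := motive) (x : SkewPolynomial R) ?_ ?_
  · have := key 0 0
    rwa [map_zero] at this
  · intro n r q _ _ hq
    exact add _ _ (key n r) hq

/-- The universal property of `R[F]`. -/
def liftHom {S : Type*} [Semiring S] (f : R →+* S) (c : S)
    (h : ∀ r, c * f r = f (r ^ p) * c) : FrobRing p R →+* S :=
  letI := frobAction p R
  SkewMonoidAlgebra.liftNCRingHom f (powersHom S c) (by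
    intro r n
    change f (((frob p R) ^ n.toAdd) r) * c ^ n.toAdd = c ^ n.toAdd * f r
    generalize n.toAdd = e
    induction e generalizing r with
    | zero => simp
    | succ e ih =>
      rw [pow_succ c, mul_assoc, h, ← mul_assoc, ← mul_assoc, ← ih, pow_succ (frob p R)]
      rfl)

lemma liftHom_coeffHom {S : Type*} [Semiring S] (f : R →+* S) (c : S)
    (h : ∀ r, c * f r = f (r ^ p) * c) (r : R) : liftHom p R f c h (coeffHom p R r) = f r := by
  let := frobAction p R
  refine (SkewMonoidAlgebra.liftNC_single (f : R →+ S) (powersHom S c) 1 r).trans ?_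
  simp

lemma liftHom_F {S : Type*} [Semiring S] (f : R →+* S) (c : S)
    (h : ∀ r, c * f r = f (r ^ p) * c) : liftHom p R f c h (F p R) = c := by
  let := frobAction p R
  refine (SkewMonoidAlgebra.liftNC_single (f : R →+ S) (powersHom S c)
    (Multiplicative.ofAdd 1) 1).trans ?_
  simp

/-- The inclusion of `R` into the opposite of `R[F]` (`R` is commutative). -/
def scalarHom : R →+* (FrobRing p R)ᵐᵒᵖ :=
  (coeffHom p R).toOpposite fun x y => by
    rw [Commute, SemiconjBy, ← map_mul, ← map_mul, mul_comm]

end FrobeniusRing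

variable (p : ℕ) [Fact p.Prime] (R : Type u) [CommRing R] [Algebra (ZMod p) R]

/-- The category `QCoh_κ(R)` of Cartier modules, i.e. of right `R[F]`-modules. -/
abbrev QCoh : Type (u + 1) := ModuleCat.{u} (FrobRing p R)ᵐᵒᵖ

/-- The forgetful functor from Cartier modules to `R`-modules. -/
abbrev toMod : QCoh p R ⥤ ModuleCat.{u} R := ModuleCat.restrictScalars (scalarHom p R)

/-- `F_*` on `R`-modules: restriction of scalars along the Frobenius. -/
abbrev pushMod : ModuleCat.{u} R ⥤ ModuleCat.{u} R := ModuleCat.restrictScalars (frob p R)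

/-- `F^♭ = Hom_R(F_* R, -)` on `R`-modules, the right adjoint of `F_*`. -/
abbrev flatMod : ModuleCat.{u} R ⥤ ModuleCat.{u} R := ModuleCat.coextendScalars (frob p R)

variable {p R}

section Elements

variable (M : QCoh p R)

/-- `m ↦ m · r` for `r : R`. -/
def rAct (r : R) : M →+ M := DistribSMul.toAddMonoidHom M (MulOpposite.op (coeffHom p R r))

/-- `m ↦ m · F`. -/
def fAct : M →+ M := DistribSMul.toAddMonoidHom M (MulOpposite.op (F p R))

variable {M}

lemma rAct_def (r : R) (m : M) : rAct M r m = MulOpposite.op (coeffHom p R r) • m := rfl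

lemma fAct_def (m : M) : fAct M m = MulOpposite.op (F p R) • m := rfl

lemma toMod_smul (r : R) (m : (toMod p R).obj M) : r • m = rAct M r m := rfl

/-- `p⁻¹`-linearity of the right action of `F`. -/
lemma fAct_rAct_pow (r : R) (m : M) : fAct M (rAct M (r ^ p) m) = rAct M r (fAct M m) := by
  rw [rAct_def, fAct_def, fAct_def, rAct_def, smul_smul, smul_smul, ← MulOpposite.op_mul,
    ← MulOpposite.op_mul, F_mul_coeffHom]

/-- An additive map between Cartier modules that commutes with the right actions of `R` and of `F`
is a morphism of Cartier modules. -/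
def homMk {M N : QCoh p R} (g : M →+ N) (hr : ∀ r m, g (rAct M r m) = rAct N r (g m))
    (hF : ∀ m, g (fAct M m) = fAct N (g m)) : M ⟶ N :=
  ModuleCat.ofHom
    { g with
      map_smul' := by
        intro s m
        change g (s • m) = s • g m
        obtain ⟨x, rfl⟩ := MulOpposite.op_surjective s
        induction x using frobRing_induction generalizing m with
        | add x y hx hy => rw [MulOpposite.op_add, add_smul, add_smul, map_add, hx, hy]
        | mono r e =>
          induction e generalizing m with
          | zero => rw [pow_zero, mul_one]; exact hr r m
          | succ e ih =>
            rw [pow_succ, ← mul_assoc, MulOpposite.op_mul, mul_smul, mul_smul, ← ih]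
            exact hF _ }

@[simp] lemma homMk_apply {M N : QCoh p R} (g : M →+ N) (hr hF) (m : M) :
    (homMk g hr hF).hom m = g m := rfl

lemma hom_rAct {M N : QCoh p R} (f : M ⟶ N) (r : R) (m : M) :
    f.hom (rAct M r m) = rAct N r (f.hom m) := map_smul f.hom _ _

lemma hom_fAct {M N : QCoh p R} (f : M ⟶ N) (m : M) :
    f.hom (fAct M m) = fAct N (f.hom m) := map_smul f.hom _ _

end Elements

section StructureMap

/-- The structural map `C_M : F_* M → M`, `m ↦ m · F`, of a Cartier module. -/
def structureMap (M : QCoh p R) : (pushMod p R).obj ((toMod p R).obj M) ⟶ (toMod p R).obj M :=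
  ModuleCat.ofHom
    (X := (pushMod p R).obj ((toMod p R).obj M)) (Y := (toMod p R).obj M)
    { toFun := fun m => fAct M m
      map_add' := fun x y => (fAct M).map_add x y
      map_smul' := fun r m => fAct_rAct_pow (M := M) r m }

/-- The adjoint structural map `κ_M : M → F^♭ M` of `R`-modules, corresponding to `C_M` under
the adjunction `F_* ⊣ F^♭`. -/
def adjStructureMap (M : QCoh p R) : (toMod p R).obj M ⟶ (flatMod p R).obj ((toMod p R).obj M) :=
  (ModuleCat.restrictCoextendScalarsAdj.{u, u, u} (frob p R)).homEquiv _ _ (structureMap M)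

lemma adjStructureMap_apply (M : QCoh p R) (m : M) (s : R) :
    ((adjStructureMap M).hom m : (flatMod p R).obj ((toMod p R).obj M)) s
      = fAct M (rAct M s m) := rfl

variable (N : ModuleCat.{u} R) (c : (pushMod p R).obj N ⟶ N)

/-- The endomorphism of the additive group of `N` underlying `c : F_* N → N`. -/
def underlyingEnd : AddMonoid.End N :=
  { toFun := fun n => c.hom n
    map_zero' := map_zero c.hom
    map_add' := fun x y => map_add c.hom x y }

lemma underlyingEnd_smul (r : R) (n : N) :
    underlyingEnd N c ((r ^ p) • n) = r • underlyingEnd N c n := c.hom.map_smul r n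

/-- `r ↦ (n ↦ r • n)`, with values in the opposite of the endomorphism ring. -/
def oppositeScalars : R →+* (AddMonoid.End N)ᵐᵒᵖ :=
  (Module.toAddMonoidEnd R N).toOpposite fun x y => by
    rw [Commute, SemiconjBy, ← map_mul, ← map_mul, mul_comm]

lemma underlyingEnd_relation (r : R) :
    MulOpposite.op (underlyingEnd N c) * oppositeScalars N r
      = oppositeScalars N (r ^ p) * MulOpposite.op (underlyingEnd N c) := by
  apply MulOpposite.unop_injective
  ext n
  exact (underlyingEnd_smul N c r n).symm

/-- The action map of the right `R[F]`-module attached to an `R`-module `N` and an `R`-linear map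
`c : F_* N → N`, with `n · r = r • n` and `n · F = c n`. -/
def actionHom : (FrobRing p R)ᵐᵒᵖ →+* AddMonoid.End N :=
  RingHom.unop ((liftHom p R (oppositeScalars N) (MulOpposite.op (underlyingEnd N c))
    (underlyingEnd_relation N c)).comp (RingEquiv.opOp (FrobRing p R)).symm.toRingHom)

/-- The Cartier module attached to an `R`-module `N` and an `R`-linear map `c : F_* N → N`. -/
def ofStructureMap : QCoh p R :=
  letI : Module (FrobRing p R)ᵐᵒᵖ N := Module.compHom N (actionHom N c)
  ModuleCat.of (FrobRing p R)ᵐᵒᵖ N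

lemma ofStructureMap_rAct (r : R) (n : N) : rAct (ofStructureMap N c) r n = r • n :=
  congrArg (fun φ : (AddMonoid.End N)ᵐᵒᵖ => φ.unop n)
    (liftHom_coeffHom p R _ _ (underlyingEnd_relation N c) r)

lemma ofStructureMap_fAct (n : N) : fAct (ofStructureMap N c) n = c.hom n :=
  congrArg (fun φ : (AddMonoid.End N)ᵐᵒᵖ => φ.unop n)
    (liftHom_F p R _ _ (underlyingEnd_relation N c))

end StructureMap

section Flat

variable (p R)

/-- The Cartier module `F^♭ M = Hom_R(F_* R, M)`, whose adjoint structural map is `F^♭ (κ_M)`. -/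
def flatObj (M : QCoh p R) : QCoh p R :=
  ofStructureMap ((flatMod p R).obj ((toMod p R).obj M))
    (((ModuleCat.restrictCoextendScalarsAdj.{u, u, u} (frob p R)).homEquiv _ _).symm
      ((flatMod p R).map (adjStructureMap M)))

/-- An element of `F^♭ M`, viewed as a map `F_* R → M`. -/
def flatEval (M : QCoh p R) (φ : flatObj p R M) (s : R) : M :=
  (show (flatMod p R).obj ((toMod p R).obj M) from φ) s

variable {p R}

lemma flat_ext {M : QCoh p R} {φ ψ : flatObj p R M}
    (h : ∀ s, flatEval p R M φ s = flatEval p R M ψ s) : φ = ψ :=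
  ModuleCat.CoextendScalars.ext (LinearMap.ext h)

lemma flatEval_rAct {M : QCoh p R} (r : R) (φ : flatObj p R M) (s : R) :
    flatEval p R M (rAct _ r φ) s = flatEval p R M φ (s * r) := by
  unfold flatObj at φ
  rw [show rAct (flatObj p R M) r φ = _ from ofStructureMap_rAct _ _ r φ]
  rfl

/-- The structural map of `F^♭ M` sends `φ` to `s ↦ C_M (s φ(1))`. -/
lemma flatEval_fAct {M : QCoh p R} (φ : flatObj p R M) (s : R) :
    flatEval p R M (fAct _ φ) s = fAct M (rAct M s (flatEval p R M φ 1)) := by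
  unfold flatObj at φ
  rw [show fAct (flatObj p R M) φ = _ from ofStructureMap_fAct _ _ φ]
  rfl

variable (p R)

/-- The functor `F^♭` on Cartier modules: on underlying `R`-modules it is `Hom_R(F_* R, -)`. -/
def flat : QCoh p R ⥤ QCoh p R where
  obj := flatObj p R
  map {M N} f := homMk
    (((flatMod p R).map ((toMod p R).map f)).hom.toAddMonoidHom :
      flatObj p R M →+ flatObj p R N)
    (by
      intro r φ
      apply flat_ext
      intro s
      rw [flatEval_rAct]
      exact congrArg f.hom (flatEval_rAct r φ s))
    (by
      intro φ
      apply flat_ext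
      intro s
      rw [flatEval_fAct]
      refine (congrArg f.hom (flatEval_fAct φ s)).trans ?_
      rw [hom_fAct, hom_rAct]
      rfl)
  map_id M := by
    ext φ
    rfl
  map_comp f g := by
    ext φ
    rfl

/-- The adjoint structural map `κ_M : M → F^♭ M`, as a morphism of Cartier modules. -/
def kappaApp (M : QCoh p R) : M ⟶ flatObj p R M :=
  homMk ((adjStructureMap M).hom.toAddMonoidHom : M →+ flatObj p R M)
    (by
      intro r m
      apply flat_ext
      intro s
      rw [flatEval_rAct]
      change fAct M (rAct M s (rAct M r m)) = fAct M (rAct M (s * r) m)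
      congr 1
      simp only [rAct_def, smul_smul, ← MulOpposite.op_mul, ← map_mul, mul_comm])
    (by
      intro m
      apply flat_ext
      intro s
      rw [flatEval_fAct]
      change fAct M (rAct M s (fAct M m)) = fAct M (rAct M s (fAct M (rAct M 1 m)))
      simp [rAct_def])

/-- `κ_M(m)` is the map `s ↦ C_M (s m)`. -/
lemma flatEval_kappaApp (M : QCoh p R) (m : M) (s : R) :
    flatEval p R M ((kappaApp p R M).hom m) s = fAct M (rAct M s m) := rfl

/-- The adjoint structural maps `κ_M`, as a natural transformation. -/
def kappa : 𝟭 (QCoh p R) ⟶ flat p R where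
  app M := kappaApp p R M
  naturality M N f := by
    ext m
    apply flat_ext
    intro s
    change fAct N (rAct N s (f.hom m)) = f.hom (fAct M (rAct M s m))
    rw [hom_fAct, hom_rAct]

/-- A Cartier module is a unit Cartier module if `κ_M : M → F^♭ M` is an isomorphism. -/
def isUnit : ObjectProperty (QCoh p R) := fun M => IsIso ((kappa p R).app M)

/-- The category of unit Cartier modules, a full subcategory of `QCoh_κ(R)`. -/
abbrev QCohUnit : Type (u + 1) := (isUnit p R).FullSubcategory

/-- The iterates `F^{e♭}` of `F^♭`. -/
def flatPow : ℕ → (QCoh p R ⥤ QCoh p R)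
  | 0 => 𝟭 _
  | e + 1 => flatPow e ⋙ flat p R

/-- The transition morphisms `F^{e♭}(κ_M) : F^{e♭} M → F^{(e+1)♭} M`. -/
def flatPowStep : ∀ e : ℕ, flatPow p R e ⟶ flatPow p R (e + 1)
  | 0 => kappa p R
  | e + 1 => Functor.whiskerRight (flatPowStep e) (flat p R)

/-- The directed system `M → F^♭ M → F^{2♭} M → ⋯`, functorially in `M`. -/
def flatSystem : ℕ ⥤ (QCoh p R ⥤ QCoh p R) := Functor.ofSequence (flatPowStep p R)

/-- The unitalization functor `u(M) = colim_e F^{e♭} M`. -/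
def unitalization : QCoh p R ⥤ QCoh p R := colimit (flatSystem p R)

/-- The natural transformation `η : id → u`, the map from the term `e = 0` to the colimit. -/
def eta : 𝟭 (QCoh p R) ⟶ unitalization p R := colimit.ι (flatSystem p R) 0

end Flat

section Nilpotent

/-- A Cartier submodule is nilpotent if some power of `F` acts as zero on it. -/
def IsNilpotentSubmodule {M : QCoh p R} (N : Submodule (FrobRing p R)ᵐᵒᵖ M) : Prop :=
  ∃ e : ℕ, ∀ n ∈ N, MulOpposite.op (F p R ^ e) • n = 0

variable (p R) in
/-- A Cartier module is locally nilpotent if it is the union of its nilpotent Cartier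
submodules. -/
def LNil : ObjectProperty (QCoh p R) := fun M =>
  ∀ m : M, ∃ N : Submodule (FrobRing p R)ᵐᵒᵖ M, IsNilpotentSubmodule N ∧ m ∈ N

lemma op_mul_smul {M : QCoh p R} (a b : FrobRing p R) (m : M) :
    MulOpposite.op (a * b) • m = MulOpposite.op b • MulOpposite.op a • m := by
  rw [MulOpposite.op_mul, mul_smul]

lemma lnil_iff (M : QCoh p R) :
    LNil p R M ↔ ∀ m : M, ∃ e : ℕ, ∀ r : R,
      MulOpposite.op (F p R ^ e) • MulOpposite.op (coeffHom p R r) • m = 0 := by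
  constructor
  · intro h m
    obtain ⟨N, ⟨e, he⟩, hm⟩ := h m
    exact ⟨e, fun r => he _ (N.smul_mem _ hm)⟩
  · intro h m
    obtain ⟨e, he⟩ := h m
    refine ⟨Submodule.span _ {m}, ⟨e, ?_⟩, Submodule.mem_span_singleton_self m⟩
    intro n hn
    obtain ⟨s, rfl⟩ := Submodule.mem_span_singleton.1 hn
    obtain ⟨x, rfl⟩ := MulOpposite.op_surjective s
    induction x using frobRing_induction with
    | add x y hx hy =>
      rw [MulOpposite.op_add, add_smul, smul_add,
        hx (Submodule.mem_span_singleton.2 ⟨_, rfl⟩), hy (Submodule.mem_span_singleton.2 ⟨_, rfl⟩),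
        add_zero]
    | mono r a =>
      rw [← op_mul_smul, mul_assoc, ← pow_add, add_comm, pow_add, op_mul_smul, op_mul_smul, he,
        smul_zero]

variable (p R) in
lemma frob_pow_apply (e : ℕ) (r : R) : (frob p R ^ e) r = r ^ p ^ e := by
  induction e generalizing r with
  | zero => simp
  | succ e ih =>
    rw [pow_succ]
    change (frob p R ^ e) (r ^ p) = _
    rw [ih, ← pow_mul, ← pow_succ']

variable (p R) in
lemma frob_pow_finite [h : IsFFinite p R] (e : ℕ) : (frob p R ^ e).Finite := by
  induction e with
  | zero => exact RingHom.Finite.id R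
  | succ e ih =>
    rw [pow_succ]
    exact RingHom.Finite.comp ih h.finite

lemma finite_induction {A B : Type*} [CommRing A] [CommRing B] {f : A →+* B} (hf : f.Finite) :
    ∃ S : Finset B, ∀ P : B → Prop, (∀ s ∈ S, P s) → P 0 → (∀ x y, P x → P y → P (x + y)) →
      (∀ b x, P x → P (f b * x)) → ∀ r, P r := by
  let := f.toAlgebra
  obtain ⟨S, hS⟩ := (hf : Module.Finite A B).fg_top
  refine ⟨S, fun P hP h0 hadd hmul r => ?_⟩
  have hr : r ∈ Submodule.span A (S : Set B) := hS ▸ Submodule.mem_top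
  induction hr using Submodule.span_induction with
  | mem s hs => exact hP s hs
  | zero => exact h0
  | add x y _ _ hx hy => exact hadd x y hx hy
  | smul b x _ hx => exact hmul b x hx

lemma hom_op_smul {M N : QCoh p R} (f : M ⟶ N) (a : FrobRing p R) (m : M) :
    f.hom (MulOpposite.op a • m) = MulOpposite.op a • f.hom m := map_smul f.hom _ _

/-- An extension of locally nilpotent Cartier modules is locally nilpotent; this uses that `R` is
`F`-finite. -/
lemma lnil_extension [IsFFinite p R] {M' M M'' : QCoh p R} (f : M' ⟶ M) (g : M ⟶ M'')
    (hfg : ∀ m, g.hom m = 0 → ∃ m', f.hom m' = m)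
    (h' : LNil p R M') (h'' : LNil p R M'') : LNil p R M := by
  rw [lnil_iff] at h' h'' ⊢
  intro m
  obtain ⟨e, he⟩ := h'' (g.hom m)
  have key : ∀ s : R, ∃ d : ℕ, ∀ a : R, MulOpposite.op (F p R ^ d) •
      MulOpposite.op (coeffHom p R a) • MulOpposite.op (F p R ^ e) •
        MulOpposite.op (coeffHom p R s) • m = 0 := by
    intro s
    obtain ⟨m', hm'⟩ := hfg (MulOpposite.op (F p R ^ e) • MulOpposite.op (coeffHom p R s) • m)
      (by rw [hom_op_smul, hom_op_smul, he])
    obtain ⟨d, hd⟩ := h' m'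
    refine ⟨d, fun a => ?_⟩
    rw [← hm', ← hom_op_smul, ← hom_op_smul, hd, map_zero]
  choose d hd using key
  obtain ⟨S, hS⟩ := finite_induction (frob_pow_finite p R e)
  refine ⟨e + S.sup d, fun r => ?_⟩
  have main : ∀ r a : R,
      MulOpposite.op (F p R ^ S.sup d) • MulOpposite.op (coeffHom p R a) •
        MulOpposite.op (F p R ^ e) • MulOpposite.op (coeffHom p R r) • m = 0 := by
    refine hS _ ?_ ?_ ?_ ?_
    · intro s hs a
      obtain ⟨k, hk⟩ := Nat.exists_eq_add_of_le (Finset.le_sup (f := d) hs)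
      rw [hk, pow_add, op_mul_smul, hd, smul_zero]
    · intro a
      simp
    · intro x y hx hy a
      rw [map_add, MulOpposite.op_add, add_smul, smul_add, smul_add, smul_add, hx, hy, add_zero]
    · intro b x hx a
      rw [frob_pow_apply]
      have hrel : coeffHom p R (b ^ p ^ e * x) * F p R ^ e
          = coeffHom p R x * (F p R ^ e * coeffHom p R b) := by
        rw [mul_comm, map_mul, mul_assoc, F_pow_mul_coeffHom]
      rw [← op_mul_smul (coeffHom p R (b ^ p ^ e * x)), hrel, op_mul_smul, op_mul_smul,
        ← op_mul_smul (coeffHom p R b), ← map_mul]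
      exact hx (b * a)
  have := main r 1
  rw [map_one, MulOpposite.op_one, one_smul, ← op_mul_smul, ← pow_add] at this
  exact this

/-- If `R` is `F`-finite, the locally nilpotent Cartier modules form a Serre class. -/
instance [IsFFinite p R] : (LNil p R).IsSerreClass where
  exists_zero := ⟨ModuleCat.of _ PUnit, ModuleCat.isZero_of_subsingleton _, fun m =>
    ⟨⊤, ⟨0, fun _ _ => Subsingleton.elim _ _⟩, trivial⟩⟩
  prop_of_mono {M N} f hf hN := by
    rw [lnil_iff] at hN ⊢
    intro m
    obtain ⟨e, he⟩ := hN (f.hom m)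
    refine ⟨e, fun r => (ModuleCat.mono_iff_injective f).1 hf ?_⟩
    change f.hom _ = f.hom _
    rw [hom_op_smul, hom_op_smul, he, map_zero]
  prop_of_epi {M N} f hf hM := by
    rw [lnil_iff] at hM ⊢
    intro n
    obtain ⟨m, rfl⟩ := (ModuleCat.epi_iff_surjective f).1 hf n
    obtain ⟨e, he⟩ := hM m
    refine ⟨e, fun r => ?_⟩
    change _ • _ • f.hom m = 0
    rw [← hom_op_smul, ← hom_op_smul, he, map_zero]
  prop_X₂_of_shortExact {S} hS h₁ h₃ :=
    lnil_extension S.f S.g (fun m hm => (S.moduleCat_exact_iff.1 hS.exact) m hm) h₁ h₃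

end Nilpotent

section Crystals

variable (p R) [IsFFinite p R]

/-- The category of quasi-coherent Cartier crystals `QCrys_κ(R) = QCoh_κ(R) / LNil_κ(R)`: the
localization of `QCoh_κ(R)` at the morphisms with locally nilpotent kernel and cokernel. -/
abbrev QCrys : Type (u + 1) := (LNil p R).isoModSerre.Localization

/-- The localization functor `π`. -/
abbrev crysLoc : QCoh p R ⥤ QCrys p R := (LNil p R).isoModSerre.Q

end Crystals

end Cartier

end

/-! The class `isoModSerre` of morphisms inverted by `π` is that of a reflective localization, with
unit Cartier modules as local objects and `u` as reflector. Three facts suffice.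

Unit modules are local (`isoModSerre_le_isLocal`). If `N` is unit, iterating `κ_N` shows that every
`p⁻ᵉ`-linear map `R → N` has the form `s ↦ n · s Fᵉ` for a unique `n`
(`existsUnique_act_of_isUnit`). For `f : M → M'` with locally nilpotent kernel and cokernel, `m' · s
Fᵉ` lies in the image of `f` for `e` large, so a map `M → N` prescribes all `n · s Fᵉ` for the image
`n` of `m'`, hence `n` itself.

The map `η_M` lies in the class (`isoModSerre_eta`). Kernel and cokernel of `κ_M` are killed by `R
F`, every transition map is a `κ` (`flatPowStep_app`), and elementwise nilpotence passes to the
colimit.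

The module `u(M)` is unit (`isUnit_unitalization`). Over a noetherian `F`-finite ring, `F_* R` is
finitely presented, so a map `F_* R → u(M)` comes from a stage `F^{e♭} M`; there it is itself an
element of stage `e + 1`, and its image in `u(M)` is the required preimage under `κ`.

The rest is formal (`exists_localization_equivalence`). -/

namespace Cartier

/-! ### Reflections and localizations of categories -/

section Reflection

variable {C : Type*} [Category* C] {P : ObjectProperty C} {W : MorphismProperty C} {L : C ⥤ C}
  (hL : ∀ X, P (L.obj X)) (η : 𝟭 C ⟶ L) (hη : ∀ X, W (η.app X)) (hW : W ≤ P.isLocal)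

-- Lets Mathlib's criterion for reflectors apply to `W`: a left adjoint of a fully faithful functor
-- is a localization at the morphisms it inverts.
include hη hW in
lemma eq_inverseImage_isomorphisms_of_reflection [W.HasTwoOutOfThreeProperty]
    [W.RespectsIso] [W.ContainsIdentities] :
    W = (MorphismProperty.isomorphisms _).inverseImage (P.lift L hL) := by
  have key {X Y : C} (f : X ⟶ Y) (hf : P.isLocal f) :
      IsIso ((P.lift L hL).map f) := by
    have nat : f ≫ η.app Y = η.app X ≫ L.map f := η.naturality f
    -- Two-out-of-three in the naturality square; a local morphism between objects satisfying `P` is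
    -- invertible.
    have h : P.isLocal (L.map f) := by
      refine P.isLocal.of_precomp _ _ (hW _ (hη X)) ?_
      rw [← nat]
      exact P.isLocal.comp_mem _ _ hf (hW _ (hη Y))
    have : IsIso (P.ι.map ((P.lift L hL).map f)) :=
      (P.isLocal_iff_isIso _ (hL X) (hL Y)).1 h
    exact isIso_of_fully_faithful P.ι _
  have key' {X Y : C} (f : X ⟶ Y) (hf : IsIso ((P.lift L hL).map f)) : W f := by
    have nat : f ≫ η.app Y = η.app X ≫ L.map f := η.naturality f
    have h : IsIso (L.map f) := inferInstanceAs (IsIso (P.ι.map ((P.lift L hL).map f)))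
    refine W.of_postcomp _ _ (hη Y) ?_
    rw [nat]
    exact W.comp_mem _ _ (hη X) (W.of_isIso _)
  exact le_antisymm (fun _ _ f hf => key f (hW _ hf)) fun _ _ f hf => key' f hf

/-- A natural transformation from the identity whose components are `P`-local and whose values
satisfy `P` exhibits the full subcategory defined by `P` as reflective. -/
noncomputable def reflectionAdj (hη : ∀ X, P.isLocal (η.app X)) : P.lift L hL ⊣ P.ι :=
  Adjunction.mkOfHomEquiv
    { homEquiv := fun X Y => (P.fullyFaithfulι.homEquiv (X := (P.lift L hL).obj X)).trans
        (ObjectProperty.isLocal.homEquiv (hη X) Y.obj Y.property)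
      homEquiv_naturality_left_symm := by
        intro X' X Y f g
        apply ((P.fullyFaithfulι.homEquiv (X := (P.lift L hL).obj X')).trans
          (ObjectProperty.isLocal.homEquiv (hη X') Y.obj Y.property)).injective
        rw [Equiv.apply_symm_apply]
        have nat : f ≫ η.app X = η.app X' ≫ L.map f := η.naturality f
        have h : η.app X ≫ (ObjectProperty.isLocal.homEquiv (hη X) Y.obj Y.property).symm g = g :=
          (ObjectProperty.isLocal.homEquiv (hη X) Y.obj Y.property).apply_symm_apply g
        change f ≫ g = η.app X' ≫ L.map f ≫
          (ObjectProperty.isLocal.homEquiv (hη X) Y.obj Y.property).symm g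
        rw [← reassoc_of% nat, h]
      homEquiv_naturality_right := by
        intro X Y Y' f g
        exact (Category.assoc _ _ _).symm }

lemma reflectionAdj_unit_app (hη : ∀ X, P.isLocal (η.app X)) (X : C) :
    (reflectionAdj hL η hη).unit.app X = η.app X :=
  (Adjunction.mkOfHomEquiv_unit_app _ _).trans (Category.comp_id _)

include hL hη hW in
/-- A reflector onto the `P`-local objects identifies the localization at `W` with the full
subcategory defined by `P`. -/
theorem exists_localization_equivalence [W.HasTwoOutOfThreeProperty] [W.RespectsIso]
    [W.ContainsIdentities] {D : Type*} [Category* D] (Q : C ⥤ D) [Q.IsLocalization W] :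
    ∃ (r : D ⥤ C) (adj : Q ⊣ r) (hr : ∀ X, P (r.obj X)) (E : P.FullSubcategory ≌ D)
      (e : Q ⋙ r ≅ L), E.functor = P.ι ⋙ Q ∧ E.inverse = P.lift r hr ∧
        ∀ X, adj.unit.app X ≫ e.hom.app X = η.app X := by
  have hη' : ∀ X, P.isLocal (η.app X) := fun X => hW _ (hη X)
  let adj := reflectionAdj hL η hη'
  have : (P.lift L hL).IsLocalization W := by
    rw [eq_inverseImage_isomorphisms_of_reflection hL η hη hW]
    exact adj.isLocalization
  let E₀ := Localization.uniq Q (P.lift L hL) W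
  let α : Q ⋙ E₀.functor ≅ P.lift L hL := Localization.compUniqFunctor Q (P.lift L hL) W
  let β : P.lift L hL ⋙ E₀.inverse ≅ Q :=
    Functor.isoWhiskerRight α.symm E₀.inverse ≪≫ Functor.associator _ _ _ ≪≫
      Functor.isoWhiskerLeft Q E₀.unitIso.symm ≪≫ Q.rightUnitor
  let r : D ⥤ C := E₀.functor ⋙ P.ι
  have hr : ∀ X, P (r.obj X) := fun X => (E₀.functor.obj X).property
  -- The counit of the reflection is invertible because `P.ι` is fully faithful.
  let γ : E₀.inverse ≅ P.ι ⋙ Q :=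
    E₀.inverse.leftUnitor.symm ≪≫
      Functor.isoWhiskerRight (asIso adj.counit).symm E₀.inverse ≪≫
      Functor.associator _ _ _ ≪≫ Functor.isoWhiskerLeft P.ι β
  -- Changing the functor and inverse of `E₀.symm` along `γ` and the identity makes both required
  -- equalities of functors hold by `rfl`.
  refine ⟨r, (adj.comp E₀.symm.toAdjunction).ofNatIsoLeft β, hr,
    (E₀.symm.changeFunctor γ).changeInverse (Iso.refl _),
    Functor.isoWhiskerRight α P.ι, rfl, rfl, fun X => ?_⟩
  have h := reflectionAdj_unit_app hL η hη' X
  have h₁ := congrArg (·.hom)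
    (E₀.counitIso.inv_hom_id_app ((P.lift L hL).obj X))
  have h₂ := congrArg (·.hom) (E₀.counitInv_functor_comp (Q.obj X))
  have h₃ := congrArg (·.hom) (α.inv_hom_id_app X)
  dsimp at h₁ h₂ h₃
  simp [β, r, adj, h]
  rw [reassoc_of% h₁, reassoc_of% h₂]
  erw [h₃, Category.comp_id]

end Reflection

variable {p : ℕ} [Fact p.Prime] {R : Type u} [CommRing R] [Algebra (ZMod p) R]

/-! ### The right action of the elements `r Fᵉ` -/

section FrobeniusAction

variable {M N : QCoh p R}

/-- `m ↦ m · r Fᵉ`. -/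
noncomputable def act (e : ℕ) (r : R) : M →+ M :=
  DistribSMul.toAddMonoidHom M (MulOpposite.op (coeffHom p R r * F p R ^ e))

lemma act_def (e : ℕ) (r : R) (m : M) :
    act e r m = MulOpposite.op (coeffHom p R r * F p R ^ e) • m := rfl

lemma act_add (e : ℕ) (r s : R) (m : M) : act e (r + s) m = act e r m + act e s m := by
  simp only [act_def, map_add, add_mul, MulOpposite.op_add, add_smul]

lemma act_zero_scalar (e : ℕ) (m : M) : act e (0 : R) m = 0 := by
  simp [act_def]

lemma act_zero_one (m : M) : act 0 (1 : R) m = m := by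
  simp [act_def]

/-- This is the product `s Fᵈ · r Fᵉ = s r^(pᵈ) F^(d+e)` in `R[F]`, to which the later computations
with elements reduce. -/
lemma act_act (d e : ℕ) (r s : R) (m : M) :
    act e r (act d s m) = act (d + e) (s * r ^ p ^ d) m := by
  rw [act_def, act_def, act_def, ← op_mul_smul, mul_assoc, ← mul_assoc (F p R ^ d),
    F_pow_mul_coeffHom, map_mul, mul_assoc, mul_assoc, pow_add]

lemma act_act_comm (e : ℕ) (r s : R) (m : M) :
    act 0 r (act e s m) = act e (s * r ^ p ^ e) m := by
  rw [act_act, add_zero]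

lemma act_act_zero (e : ℕ) (r s : R) (m : M) : act e r (act 0 s m) = act e (s * r) m := by
  rw [act_act, zero_add, pow_zero, pow_one]

lemma hom_act (f : M ⟶ N) (e : ℕ) (r : R) (m : M) :
    f.hom (act e r m) = act e r (f.hom m) := map_smul f.hom _ _

lemma rAct_eq_act (r : R) (m : M) : rAct M r m = act 0 r m := by
  rw [rAct_def, act_def, pow_zero, mul_one]

lemma fAct_eq_act (m : M) : fAct M m = act 1 (1 : R) m := by
  rw [fAct_def, act_def, map_one, one_mul, pow_one]

lemma fAct_rAct (s : R) (m : M) : fAct M (rAct M s m) = act 1 s m := by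
  rw [rAct_eq_act, fAct_eq_act, act_act_zero, mul_one]

lemma lnil_iff_act (M : QCoh p R) :
    LNil p R M ↔ ∀ m : M, ∃ e : ℕ, ∀ r : R, act e r m = 0 := by
  rw [lnil_iff]
  simp only [act_def, op_mul_smul]

end FrobeniusAction

/-! ### Isomorphisms modulo locally nilpotent modules -/

section IsoModSerre

variable [IsFFinite p R] {M N : QCoh p R}

/-- A morphism is an isomorphism modulo locally nilpotent Cartier modules if and only if its kernel
and its cokernel are killed elementwise by some `R Fᵉ`. -/
lemma isoModSerre_iff_act (f : M ⟶ N) :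
    (LNil p R).isoModSerre f ↔
      (∀ m, f.hom m = 0 → ∃ e : ℕ, ∀ r : R, act e r m = 0) ∧
        ∀ n, ∃ e : ℕ, ∀ r : R, ∃ m, f.hom m = act e r n := by
  rw [ObjectProperty.isoModSerre_iff, ObjectProperty.monoModSerre_iff,
    ObjectProperty.epiModSerre_iff, (LNil p R).prop_iff_of_iso (ModuleCat.kernelIsoKer f),
    (LNil p R).prop_iff_of_iso (ModuleCat.cokernelIsoRangeQuotient f), lnil_iff_act,
    lnil_iff_act]
  refine and_congr ?_ ?_
  · refine ⟨fun h m hm => ?_, fun h m => ?_⟩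
    · obtain ⟨e, he⟩ := h ⟨m, hm⟩
      exact ⟨e, fun r => congrArg Subtype.val (he r)⟩
    · obtain ⟨e, he⟩ := h m.1 m.2
      exact ⟨e, fun r => Subtype.ext (he r)⟩
  · refine ⟨fun h n => ?_, fun h n => ?_⟩
    · obtain ⟨e, he⟩ := h (Submodule.Quotient.mk n)
      exact ⟨e, fun r => (Submodule.Quotient.mk_eq_zero f.hom.range).1 (he r)⟩
    · obtain ⟨n, rfl⟩ := Submodule.Quotient.mk_surjective _ n
      obtain ⟨e, he⟩ := h n
      exact ⟨e, fun r => (Submodule.Quotient.mk_eq_zero f.hom.range).2 (he r)⟩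

end IsoModSerre

/-! ### Unit Cartier modules as local objects -/

section Unit

variable {M N : QCoh p R}

lemma isIso_iff_bijective (f : M ⟶ N) : IsIso f ↔ Function.Bijective f.hom :=
  ConcreteCategory.isIso_iff_bijective f

/-- The element of `F^♭ M` given by a `p⁻¹`-linear map `R → M`. -/
noncomputable def flatMk (φ : R →+ M) (hφ : ∀ r s, φ (s * r ^ p) = act 0 r (φ s)) : flatObj p R M :=
  show (flatMod p R).obj ((toMod p R).obj M) from
    (ModuleCat.CoextendScalars.equiv (frob p R) ((toMod p R).obj M)).symm
      { φ with
        map_smul' := fun r s => by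
          refine (congrArg φ (mul_comm (r ^ p) s)).trans ((hφ r s).trans ?_)
          exact (rAct_eq_act r (φ s)).symm }

@[simp] lemma flatEval_flatMk (φ : R →+ M) (hφ) (s : R) :
    flatEval p R M (flatMk φ hφ) s = φ s := rfl

lemma flatEval_mul_pow (φ : flatObj p R M) (r s : R) :
    flatEval p R M φ (s * r ^ p) = act 0 r (flatEval p R M φ s) := by
  rw [← rAct_eq_act, mul_comm]
  exact (show (flatMod p R).obj ((toMod p R).obj M) from φ).map_smul r s

lemma flatEval_add (φ : flatObj p R M) (r s : R) :
    flatEval p R M φ (r + s) = flatEval p R M φ r + flatEval p R M φ s :=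
  (show (flatMod p R).obj ((toMod p R).obj M) from φ).map_add r s

lemma flatEval_kappa (m : M) (s : R) :
    flatEval p R M ((kappaApp p R M).hom m) s = act 1 s m :=
  fAct_rAct s m

/-- In a unit Cartier module, every `p⁻ᵉ`-linear map `R → N` is `s ↦ n · s Fᵉ` for a unique `n`. -/
lemma existsUnique_act_of_isUnit (hN : isUnit p R N) (e : ℕ) (φ : R →+ N)
    (hφ : ∀ r s, φ (s * r ^ p ^ e) = act 0 r (φ s)) : ∃! n, ∀ s, act e s n = φ s := by
  have hN' : Function.Bijective (kappaApp p R N).hom := (isIso_iff_bijective _).1 hN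
  have h1 (φ : R →+ N) (hφ : ∀ r s, φ (s * r ^ p) = act 0 r (φ s)) :
      ∃! n, ∀ s, act 1 s n = φ s := by
    obtain ⟨n, hn⟩ := hN'.2 (flatMk φ hφ)
    have hn' : ∀ s, act 1 s n = φ s := fun s => by
      rw [← flatEval_kappa, hn, flatEval_flatMk]
    refine ⟨n, hn', fun m hm => hN'.1 (flat_ext fun s => ?_)⟩
    rw [flatEval_kappa, flatEval_kappa, hm, hn']
  induction e generalizing φ with
  | zero =>
    have key : ∀ s, act 0 s (φ 1) = φ s := fun s => by
      rw [← hφ, pow_zero, pow_one, one_mul]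
    refine ⟨φ 1, key, fun m hm => ?_⟩
    rw [← act_zero_one (p := p) (R := R) m, hm 1]
  | succ e ih =>
    -- For fixed `s` the right side is `p⁻¹`-linear in `r`, so some `χ s` represents it. Uniqueness
    -- makes `χ` additive and `p⁻ᵉ`-linear, and the element representing `χ` represents `φ`.
    have h2 (s : R) : ∃! n, ∀ r, act 1 r n = φ (s * r ^ p ^ e) := by
      refine h1 (φ.comp ((AddMonoidHom.mulLeft s).comp (frob p R ^ e : R →+* R).toAddMonoidHom)
        |>.copy (fun r => φ (s * r ^ p ^ e)) ?_) ?_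
      · ext r
        simp [← frob_pow_apply]
      · intro r t
        change φ (s * (t * r ^ p) ^ p ^ e) = act 0 r (φ (s * t ^ p ^ e))
        rw [← hφ, mul_pow, ← pow_mul, ← pow_succ', mul_assoc]
    choose χ hχ hχu using h2
    have hadd (s t : R) : χ (s + t) = χ s + χ t := by
      symm
      refine hχu _ _ fun r => ?_
      rw [map_add, hχ, hχ, ← map_add, add_mul]
    obtain ⟨n, hn, hnu⟩ := ih (AddMonoidHom.mk' χ hadd) (by
      intro r s
      symm
      refine hχu _ _ fun t => ?_
      change act 1 t (act 0 r (χ s)) = _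
      rw [act_act_zero, hχ, mul_pow, mul_assoc])
    have hact (m : N) (s r : R) : act 1 r (act e s m) = act (e + 1) (s * r ^ p ^ e) m :=
      act_act e 1 r s m
    refine ⟨n, fun s => ?_, fun m hm => hnu m fun s => hχu _ _ fun r => ?_⟩
    · have := hact n s 1
      rw [one_pow, mul_one] at this
      rw [← this, hn]
      change act 1 1 (χ s) = _
      rw [hχ, one_pow, mul_one]
    · rw [hact, hm]

/-- Equalities in a unit module can thus be tested after applying all `s Fᵉ` for one fixed `e`. -/
lemma eq_zero_of_act_eq_zero (hN : isUnit p R N) {e : ℕ} {n : N}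
    (h : ∀ s : R, act e s n = 0) : n = 0 :=
  (existsUnique_act_of_isUnit hN e 0 fun r s => by simp).unique h fun s => by simp

/-- Unit Cartier modules are local for the isomorphisms modulo locally nilpotent Cartier modules. -/
lemma isoModSerre_le_isLocal [IsFFinite p R] :
    (LNil p R).isoModSerre ≤ (isUnit p R).isLocal := by
  intro M M' f hf N hN
  obtain ⟨hker, hcoker⟩ := (isoModSerre_iff_act f).1 hf
  constructor
  · intro g₁ g₂ h
    ext m'
    obtain ⟨e, he⟩ := hcoker m'
    refine sub_eq_zero.1 (eq_zero_of_act_eq_zero (e := e) hN fun s => ?_)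
    obtain ⟨m, hm⟩ := he s
    have : g₁.hom (f.hom m) = g₂.hom (f.hom m) := congrArg (fun k => k.hom m) h
    rw [map_sub, ← hom_act, ← hom_act, ← hm, this, sub_self]
  · intro g
    -- Elements of the kernel of `f` are killed by some `R Fᵉ`, and `N` has no nonzero such
    -- elements.
    have hg {m₁ m₂ : M} (h : f.hom m₁ = f.hom m₂) : g.hom m₁ = g.hom m₂ := by
      obtain ⟨e, he⟩ := hker (m₁ - m₂) (by rw [map_sub, h, sub_self])
      refine sub_eq_zero.1 (eq_zero_of_act_eq_zero (e := e) hN fun s => ?_)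
      rw [← map_sub, ← hom_act, he, map_zero]
    -- By `hg`, the value of `g` on a preimage of `m' · r Fᵉ` does not depend on the preimage and is
    -- `p⁻ᵉ`-linear in `r`; `n` represents it.
    have hex (m' : M') : ∃ n : N, ∃ e : ℕ, ∀ r : R, ∃ m, f.hom m = act e r m' ∧
        g.hom m = act e r n := by
      obtain ⟨e, he⟩ := hcoker m'
      choose μ hμ using he
      obtain ⟨n, hn, -⟩ := existsUnique_act_of_isUnit hN e
        (AddMonoidHom.mk' (fun r => g.hom (μ r)) fun r s => by
          rw [← map_add]
          exact hg (by rw [map_add, hμ, hμ, hμ, act_add]))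
        (by
          intro r s
          change g.hom _ = act 0 r (g.hom _)
          rw [← hom_act]
          exact hg (by rw [hom_act, hμ, hμ, act_act_comm]))
      exact ⟨n, e, fun r => ⟨μ r, hμ r, (hn r).symm⟩⟩
    have hmono {m' : M'} {n : N} {e : ℕ} (h : ∀ r : R, ∃ m, f.hom m = act e r m' ∧
        g.hom m = act e r n) (d : ℕ) : ∀ r : R, ∃ m, f.hom m = act (e + d) r m' ∧
        g.hom m = act (e + d) r n := by
      intro r
      obtain ⟨m, hm, hm'⟩ := h r
      refine ⟨act d 1 m, ?_, ?_⟩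
      · rw [hom_act, hm, act_act, one_pow, mul_one]
      · rw [hom_act, hm', act_act, one_pow, mul_one]
    -- The relation determines `n` whatever the exponent, after raising both exponents to `e₁ + e₂`.
    -- Additivity and equivariance of `ν` then only require that the candidate value satisfy it.
    have huniq {m' : M'} {n₁ n₂ : N}
        (h₁ : ∃ e : ℕ, ∀ r : R, ∃ m, f.hom m = act e r m' ∧ g.hom m = act e r n₁)
        (h₂ : ∃ e : ℕ, ∀ r : R, ∃ m, f.hom m = act e r m' ∧ g.hom m = act e r n₂) :
        n₁ = n₂ := by
      obtain ⟨e₁, h₁⟩ := h₁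
      obtain ⟨e₂, h₂⟩ := h₂
      refine sub_eq_zero.1 (eq_zero_of_act_eq_zero (e := e₁ + e₂) hN fun s => ?_)
      obtain ⟨a, ha, ha'⟩ := hmono h₁ e₂ s
      obtain ⟨b, hb, hb'⟩ := hmono h₂ e₁ s
      rw [add_comm e₂] at hb hb'
      rw [map_sub, ← ha', ← hb', hg (ha.trans hb.symm), sub_self]
    choose ν hν using hex
    refine ⟨homMk (AddMonoidHom.mk' ν ?_) ?_ ?_, ?_⟩
    · intro a b
      refine huniq (hν _) ?_
      obtain ⟨e₁, h₁⟩ := hν a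
      obtain ⟨e₂, h₂⟩ := hν b
      refine ⟨e₁ + e₂, fun r => ?_⟩
      obtain ⟨x, hx, hx'⟩ := hmono h₁ e₂ r
      obtain ⟨y, hy, hy'⟩ := hmono h₂ e₁ r
      rw [add_comm e₂] at hy hy'
      exact ⟨x + y, by rw [map_add, map_add, hx, hy], by rw [map_add, map_add, hx', hy']⟩
    · intro r m'
      refine huniq (hν _) ?_
      obtain ⟨e, h⟩ := hν m'
      refine ⟨e, fun s => ?_⟩
      rw [rAct_eq_act, rAct_eq_act, act_act_zero, act_act_zero]
      exact h _
    · intro m'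
      refine huniq (hν _) ?_
      obtain ⟨e, h⟩ := hν m'
      refine ⟨e, fun s => ?_⟩
      -- The scalar `s ^ p` comes from `F · s Fᵉ = s ^ p F^(e+1)`.
      obtain ⟨x, hx, hx'⟩ := hmono h 1 (s ^ p)
      refine ⟨x, ?_, ?_⟩
      · rw [hx, fAct_eq_act, act_act, one_mul, pow_one, add_comm]
      · change _ = act e s (fAct N (ν m'))
        rw [hx', fAct_eq_act, act_act, one_mul, pow_one, add_comm]
    · ext m
      exact huniq (hν _) ⟨0, fun r => ⟨act 0 r m, hom_act _ _ _ _, hom_act _ _ _ _⟩⟩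

end Unit

/-! ### The unitalization and its unit property -/

section Unitalization

variable (M : QCoh p R)

/-- `κ_M (φ(r)) = φ · r F` in `F^♭ M`. -/
lemma kappaApp_flatEval (φ : flatObj p R M) (r : R) :
    (kappaApp p R M).hom (flatEval p R M φ r) = act 1 r φ := by
  apply flat_ext
  intro s
  rw [flatEval_kappa, ← fAct_rAct r φ, flatEval_fAct, flatEval_rAct, fAct_rAct, one_mul]

/-- The exponent `1` works on both sides: `κ_M(m) = 0` says that `m · s F = 0` for all `s`, and `φ ·
r F` is the image of `φ(r)`. -/
lemma isoModSerre_kappaApp [IsFFinite p R] : (LNil p R).isoModSerre (kappaApp p R M) := by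
  rw [isoModSerre_iff_act]
  refine ⟨fun m hm => ⟨1, fun s => ?_⟩, fun φ => ⟨1, fun r => ⟨_, kappaApp_flatEval M φ r⟩⟩⟩
  rw [← flatEval_kappa, hm]
  rfl

lemma flat_map_kappaApp : (flat p R).map (kappaApp p R M) = kappaApp p R (flatObj p R M) := by
  ext φ
  apply flat_ext
  intro s
  refine Eq.trans ?_ (flatEval_kappa φ s).symm
  exact kappaApp_flatEval M φ s

/-- The adjoint structural map of `F^{e♭} M` is the transition morphism `F^{e♭} (κ_M)`. -/
lemma flatPowStep_app (e : ℕ) :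
    (flatPowStep p R e).app M = kappaApp p R ((flatPow p R e).obj M) := by
  induction e with
  | zero => rfl
  | succ e ih =>
    exact (congrArg (flat p R).map ih).trans (flat_map_kappaApp _)

/-- The directed system `M → F^♭ M → F^{2♭} M → ⋯`. -/
noncomputable def stage : ℕ ⥤ QCoh p R := flatSystem p R ⋙ (evaluation _ _).obj M

/-- The map `F^{e♭} M → u(M)`. -/
noncomputable def stageι (e : ℕ) : (stage M).obj e ⟶ (unitalization p R).obj M :=
  (colimit.ι (flatSystem p R) e).app M

lemma stage_map_succ (e : ℕ) :
    (stage M).map (homOfLE (Nat.le_add_right e 1)) = kappaApp p R ((stage M).obj e) :=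
  (congrArg (fun f => f.app M) (Functor.ofSequence_map_homOfLE_succ (flatPowStep p R) e)).trans
    (flatPowStep_app M e)

lemma stage_map_stageι {e d : ℕ} (h : e ≤ d) (x : (stage M).obj e) :
    (stageι M d).hom (((stage M).map (homOfLE h)).hom x) = (stageι M e).hom x :=
  congrArg (fun f => (f.app M).hom x) (colimit.w (flatSystem p R) (homOfLE h))

lemma stage_map_map {e d k : ℕ} (h : e ≤ d) (h' : d ≤ k) (x : (stage M).obj e) :
    ((stage M).map (homOfLE h')).hom (((stage M).map (homOfLE h)).hom x) =
      ((stage M).map (homOfLE (h.trans h'))).hom x :=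
  (congrArg (fun f => f.hom x) ((stage M).map_comp (homOfLE h) (homOfLE h'))).symm

lemma kappaApp_stageι (e : ℕ) (x : (stage M).obj e) :
    (stageι M (e + 1)).hom ((kappaApp p R ((stage M).obj e)).hom x) = (stageι M e).hom x := by
  rw [← stage_map_stageι M (Nat.le_add_right e 1), stage_map_succ]
  rfl

/-- `u(M)` is the colimit of the directed system `F^{e♭} M`. -/
noncomputable def isColimitStage :
    IsColimit (C := QCoh p R) (F := stage M)
      (((evaluation _ _).obj M).mapCocone (colimit.cocone (flatSystem p R))) :=
  -- Colimits of functors are computed pointwise, so evaluation at `M` preserves them.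
  isColimitOfPreserves _ (colimit.isColimit _)

instance : PreservesFilteredColimitsOfSize.{0, 0} (forget (QCoh p R)) :=
  preservesFilteredColimitsOfSize_shrink.{0, u, 0, u} _

lemma exists_stageι_eq (x : (unitalization p R).obj M) :
    ∃ (e : ℕ) (y : (stage M).obj e), (stageι M e).hom y = x :=
  Concrete.isColimit_exists_rep _ (isColimitStage M) x

lemma exists_map_eq_zero {e : ℕ} {y : (stage M).obj e} (hy : (stageι M e).hom y = 0) :
    ∃ (d : ℕ) (h : e ≤ d), ((stage M).map (homOfLE h)).hom y = 0 := by
  obtain ⟨d, f, g, h⟩ := Concrete.isColimit_exists_of_rep_eq _ (isColimitStage M) y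
    (0 : (stage M).obj e) (hy.trans (map_zero (stageι M e).hom).symm)
  exact ⟨d, leOfHom f, h.trans (map_zero ((stage M).map g).hom)⟩

lemma isoModSerre_stage_map [IsFFinite p R] (e : ℕ) :
    (LNil p R).isoModSerre ((stage M).map (homOfLE (Nat.zero_le e))) := by
  induction e with
  | zero =>
    have : IsIso ((stage M).map (homOfLE (Nat.zero_le 0))) := by
      rw [show homOfLE (Nat.zero_le 0) = 𝟙 0 from rfl]
      infer_instance
    exact (LNil p R).isoModSerre_of_isIso _
  | succ e ih =>
    have h : (stage M).map (homOfLE (Nat.zero_le (e + 1))) =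
        (stage M).map (homOfLE (Nat.zero_le e)) ≫
          (stage M).map (homOfLE (Nat.le_add_right e 1)) := by
      rw [← Functor.map_comp, homOfLE_comp]
    rw [h, stage_map_succ]
    exact (LNil p R).isoModSerre.comp_mem _ _ ih (isoModSerre_kappaApp _)

/-- A kernel element dies at a finite stage and an element of `u(M)` comes from one, so finite
composites of the maps `κ` decide both conditions; the exponent may depend on the element. -/
lemma isoModSerre_eta [IsFFinite p R] : (LNil p R).isoModSerre ((eta p R).app M) := by
  rw [isoModSerre_iff_act]
  constructor
  · intro m hm
    obtain ⟨d, h, hd⟩ := exists_map_eq_zero M (e := 0) (y := m) hm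
    exact ((isoModSerre_iff_act _).1 (isoModSerre_stage_map M d)).1 m hd
  · intro x
    obtain ⟨d, y, rfl⟩ := exists_stageι_eq M x
    obtain ⟨e, he⟩ := ((isoModSerre_iff_act _).1 (isoModSerre_stage_map M d)).2 y
    refine ⟨e, fun r => ?_⟩
    obtain ⟨m, hm⟩ := he r
    refine ⟨m, ?_⟩
    rw [← hom_act, ← hm]
    exact (stage_map_stageι M (Nat.zero_le d) m).symm

/-- Finitely many elements of `u(M)` come from a common stage. -/
lemma exists_stageι_eq_finset {ι : Type*} (S : Finset ι) (x : ι → (unitalization p R).obj M) :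
    ∃ (e : ℕ) (y : ι → (stage M).obj e), ∀ i ∈ S, (stageι M e).hom (y i) = x i := by
  choose e y hy using fun i => exists_stageι_eq M (x i)
  classical
  refine ⟨S.sup e, fun i => if h : e i ≤ S.sup e then
    ((stage M).map (homOfLE h)).hom (y i) else 0, fun i hi => ?_⟩
  beta_reduce
  rw [dif_pos (Finset.le_sup hi), stage_map_stageι, hy]

/-- Finitely many elements of `F^{e♭} M` that vanish in `u(M)` vanish at a common later stage. -/
lemma exists_map_eq_zero_finset {ι : Type*} (S : Finset ι) {e : ℕ} (y : ι → (stage M).obj e)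
    (hy : ∀ i ∈ S, (stageι M e).hom (y i) = 0) :
    ∃ (d : ℕ) (h : e ≤ d), ∀ i ∈ S, ((stage M).map (homOfLE h)).hom (y i) = 0 := by
  classical
  induction S using Finset.induction_on with
  | empty => exact ⟨e, le_rfl, by simp⟩
  | insert a S _ ih =>
    obtain ⟨d, h, hd⟩ := ih fun i hi => hy i (Finset.mem_insert_of_mem hi)
    obtain ⟨d', h', hd'⟩ := exists_map_eq_zero M (hy a (Finset.mem_insert_self _ _))
    refine ⟨max d d', h.trans (le_max_left _ _), fun i hi => ?_⟩
    rcases Finset.mem_insert.1 hi with rfl | hi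
    · rw [← stage_map_map M h' (le_max_right _ _), hd', map_zero]
    · rw [← stage_map_map M h (le_max_left _ _), hd i hi, map_zero]

/-- As `F_* R` is finitely generated, vanishing of all `y · s F` in `u(M)` is attained at one stage
`d`; there `κ` kills `y`, and `κ` is the next transition map. -/
lemma kappaApp_unitalization_injective [IsFFinite p R] :
    Function.Injective (kappaApp p R ((unitalization p R).obj M)).hom := by
  rw [injective_iff_map_eq_zero]
  intro x hx
  obtain ⟨e, y, rfl⟩ := exists_stageι_eq M x
  have hy (s : R) : (stageι M e).hom (act 1 s y) = 0 := by
    rw [hom_act, ← flatEval_kappa, hx]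
    rfl
  obtain ⟨S, hS⟩ := finite_induction (IsFFinite.finite (p := p) (R := R))
  obtain ⟨d, h, hd⟩ := exists_map_eq_zero_finset M S (fun s => act 1 s y) fun s _ => hy s
  have hd' (s : R) : act 1 s (((stage M).map (homOfLE h)).hom y) = 0 := by
    refine hS (fun s => act 1 s (((stage M).map (homOfLE h)).hom y) = 0) ?_ ?_ ?_ ?_ s
    · intro s hs
      rw [← hom_act, hd s hs]
    · exact act_zero_scalar _ _
    · intro a b ha hb
      rw [act_add, ha, hb, add_zero]
    · intro b a ha
      have := act_act_comm 1 b a (((stage M).map (homOfLE h)).hom y)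
      rw [ha, map_zero, pow_one, mul_comm] at this
      exact this.symm
  have hk : (kappaApp p R ((stage M).obj d)).hom (((stage M).map (homOfLE h)).hom y) = 0 :=
    flat_ext fun s => (flatEval_kappa _ s).trans (hd' s)
  rw [← stage_map_stageι M h, ← kappaApp_stageι M d, hk]
  exact map_zero _

/-- As `F_* R` is finitely presented, maps `F_* R → u(M)` factor through some `F^{e♭} M`. -/
lemma exists_flatEval_stage [IsNoetherianRing R] [IsFFinite p R]
    (φ : flatObj p R ((unitalization p R).obj M)) :
    ∃ (e : ℕ) (ψ : flatObj p R ((stage M).obj e)), ∀ s,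
      (stageι M e).hom (flatEval p R _ ψ s) = flatEval p R _ φ s := by
  obtain ⟨S, hS⟩ := finite_induction (IsFFinite.finite (p := p) (R := R))
  obtain ⟨e, y, hy⟩ := exists_stageι_eq_finset M (Finset.univ : Finset S)
    fun s => flatEval p R _ φ s
  -- A presentation of `F_* R` by the free module on `S`; `θ` lifts `φ ∘ π` to stage `e`.
  let π : (S → R) →+ R := AddMonoidHom.mk' (fun c => ∑ s : S, s * frob p R (c s)) fun a b => by
    simp only [Pi.add_apply, map_add, mul_add, Finset.sum_add_distrib]
  have hπ (r : R) (c : S → R) : π (r • c) = r ^ p * π c := by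
    change ∑ s : S, (s : R) * (r * c s) ^ p = r ^ p * ∑ s : S, (s : R) * (c s) ^ p
    rw [Finset.mul_sum]
    exact Finset.sum_congr rfl fun s _ => by ring
  have hπs (r : R) : ∃ c, π c = r := by
    refine hS (fun r => ∃ c, π c = r) ?_ ⟨0, map_zero π⟩ ?_ ?_ r
    · intro s hs
      classical
      refine ⟨Pi.single ⟨s, hs⟩ 1, ?_⟩
      change ∑ t : S, (t : R) * frob p R ((Pi.single ⟨s, hs⟩ 1 : S → R) t) = s
      rw [Finset.sum_eq_single ⟨s, hs⟩]
      · simp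
      · intro b _ hb
        rw [Pi.single_eq_of_ne hb, map_zero, mul_zero]
      · simp
    · rintro _ _ ⟨a, rfl⟩ ⟨b, rfl⟩
      exact ⟨a + b, map_add π a b⟩
    · rintro b _ ⟨a, rfl⟩
      exact ⟨b • a, hπ b a⟩
  let θ : (S → R) →+ (stage M).obj e :=
    AddMonoidHom.mk' (fun c => ∑ s : S, act 0 (c s) (y s)) fun a b => by
      simp only [Pi.add_apply, act_add, Finset.sum_add_distrib]
  have hθ (r : R) (c : S → R) : θ (r • c) = act 0 r (θ c) := by
    change ∑ s : S, act 0 (r * c s) (y s) = act 0 r (∑ s : S, act 0 (c s) (y s))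
    rw [map_sum]
    exact Finset.sum_congr rfl fun s _ => by rw [act_act_zero, mul_comm]
  let Φ : R →+ (unitalization p R).obj M :=
    AddMonoidHom.mk' (flatEval p R _ φ) (flatEval_add φ)
  have hθπ (c : S → R) : (stageι M e).hom (θ c) = Φ (π c) := by
    change (stageι M e).hom (∑ s : S, act 0 (c s) (y s)) = Φ (∑ s : S, s * (c s) ^ p)
    rw [map_sum, map_sum]
    refine Finset.sum_congr rfl fun s _ => ?_
    rw [hom_act, hy s (Finset.mem_univ s)]
    exact (flatEval_mul_pow φ _ _).symm
  let K : Submodule R (S → R) :=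
    { carrier := {c | π c = 0}
      add_mem' := fun {a b} ha hb => by
        change π (a + b) = 0
        rw [map_add, show π a = 0 from ha, show π b = 0 from hb, add_zero]
      zero_mem' := map_zero π
      smul_mem' := fun r c hc => by
        change π (r • c) = 0
        rw [hπ, show π c = 0 from hc, mul_zero] }
  -- Finitely many relations suffice, so at a later stage `d` the lift kills all of `K` and descends
  -- to `F_* R`.
  obtain ⟨T, hT⟩ := (IsNoetherian.noetherian K : K.FG)
  obtain ⟨d, h, hd⟩ := exists_map_eq_zero_finset M T (fun c => θ c) fun c hc => by
    have hcK : π c = 0 := show c ∈ K from hT ▸ Submodule.subset_span hc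
    rw [hθπ, hcK, map_zero]
  let θ' : (S → R) →+ (stage M).obj d :=
    ((stage M).map (homOfLE h)).hom.toAddMonoidHom.comp θ
  have hθ' (r : R) (c : S → R) : θ' (r • c) = act 0 r (θ' c) := by
    change ((stage M).map (homOfLE h)).hom (θ (r • c)) = _
    rw [hθ, hom_act]
    rfl
  have hker (c : S → R) (hc : π c = 0) : θ' c = 0 := by
    have hc' : c ∈ Submodule.span R (T : Set (S → R)) := hT ▸ hc
    induction hc' using Submodule.span_induction with
    | mem c hcT => exact hd c hcT
    | zero => exact map_zero θ'
    | add a b ha hb iha ihb =>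
      rw [map_add, iha (show a ∈ K from hT ▸ ha), ihb (show b ∈ K from hT ▸ hb), add_zero]
    | smul r c hc' ih => rw [hθ', ih (show c ∈ K from hT ▸ hc'), map_zero]
  have hwd {a b : S → R} (hab : π a = π b) : θ' a = θ' b :=
    sub_eq_zero.1 ((map_sub θ' a b).symm.trans (hker _ (by rw [map_sub, hab, sub_self])))
  choose σ hσ using hπs
  refine ⟨d, flatMk (AddMonoidHom.mk' (fun r => θ' (σ r)) fun a b => ?_) fun r s => ?_,
    fun s => ?_⟩
  · rw [← map_add]
    exact hwd (by rw [map_add, hσ, hσ, hσ])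
  · change θ' (σ (s * r ^ p)) = act 0 r (θ' (σ s))
    rw [← hθ']
    exact hwd (by rw [hπ, hσ, hσ, mul_comm])
  · change (stageι M d).hom (((stage M).map (homOfLE h)).hom (θ (σ s))) = _
    rw [stage_map_stageι, hθπ, hσ]
    rfl

/-- The unitalization of a Cartier module is a unit Cartier module. -/
theorem isUnit_unitalization [IsNoetherianRing R] [IsFFinite p R] :
    isUnit p R ((unitalization p R).obj M) := by
  refine (isIso_iff_bijective (kappaApp p R ((unitalization p R).obj M))).2
    ⟨kappaApp_unitalization_injective M, fun φ => ?_⟩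
  obtain ⟨e, ψ, hψ⟩ := exists_flatEval_stage M φ
  -- Stage `e + 1` is by definition `F^♭` of stage `e`, so `ψ` is one of its elements. By
  -- `kappaApp_flatEval`, `ψ · s F = κ(ψ(s))`, which has the same image in `u(M)` as `ψ(s)`.
  refine ⟨(stageι M (e + 1)).hom ψ, flat_ext fun s => ?_⟩
  rw [flatEval_kappa, ← hψ, ← kappaApp_stageι, kappaApp_flatEval]
  exact (hom_act (stageι M (e + 1)) 1 s ψ).symm

end Unitalization

end Cartier

theorem mainTheorem2 (p : ℕ) [Fact p.Prime] (R : Type u) [CommRing R] [Algebra (ZMod p) R]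
    [IsNoetherianRing R] [Cartier.IsFFinite p R] :
    ∃ (ubar : Cartier.QCrys p R ⥤ Cartier.QCoh p R) (adj : Cartier.crysLoc p R ⊣ ubar)
      (hubar : ∀ X, Cartier.isUnit p R (ubar.obj X))
      (E : Cartier.QCohUnit p R ≌ Cartier.QCrys p R)
      (e : Cartier.crysLoc p R ⋙ ubar ≅ Cartier.unitalization p R),
      E.functor = (Cartier.isUnit p R).ι ⋙ Cartier.crysLoc p R ∧
      E.inverse = (Cartier.isUnit p R).lift ubar hubar ∧
      (∀ M : Cartier.QCoh p R, adj.unit.app M ≫ e.hom.app M = (Cartier.eta p R).app M) :=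
  Cartier.exists_localization_equivalence (fun M => Cartier.isUnit_unitalization M)
    (Cartier.eta p R) (fun M => Cartier.isoModSerre_eta M) Cartier.isoModSerre_le_isLocal (Cartier.crysLoc p R)
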